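/- Let $p$ be a prime, let $s,r,m\ge 1$ be integers with $rm\ge s$, and put $q=p^r$, $n=q^m-1$; assume $q^m\neq 2$. Let $L=GR(p^s,r)$ and $\mathcal R=GR(p^s,rm)\supseteq L$ be the Galois rings of characteristic $p^s$ with $p^{sr}$ and $p^{srm}$ elements. Let $h\in L[x]$ be a monic basic primitive polynomial of degree $m$ (its reduction modulo $p$ is a primitive polynomial over $\mathbb F_q$) dividing $x^n-1$ and having as a root an element $\xi\in\mathcal R$ of multiplicative order $n$. Every $c\in\mathcal R$ is uniquely $c=\sum_{i=0}^{s-1}p^i\xi_i$ with $\xi_i\in\{0,1,\xi,\dots,\xi^{n-1}\}$; put $c^f=\sum_{i=0}^{s-1}p^i\xi_i^{q}$ and let $T:\mathcal R\to L$, $T(c)=c+c^f+\cdots+c^{f^{m-1}}$, be the relative trace. The shortened Kerdock code $\mathcal K^-$ is the cyclic code of length $n$ over $L$ generated by the reciprocal polynomial of $(x^n-1)/((x-1)h(x))$, that is, the set of words $(c_0,\dots,c_{n-1})\in L^n$ for which the class of $\sum_i c_ix^i$ lies in the ideal it generates in $L[x]/(x^n-1)$. The Kerdock code $\mathcal K$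 of length $n+1=q^m$ is the set of words $(-\sum_i c_i,\,c_0,\dots,c_{n-1})$ with $(c_0,\dots,c_{n-1})\in\mathcal K^-$. Write $\xi^i=\sum_{j=1}^m b_{ji}\xi^{j-1}$ with $b_{ji}\in L$, $b_i=(b_{1i},\dots,b_{mi})$ for $0\le i\le n-1$, and $b_\infty=(0,\dots,0)$. For $0\le\nu\le m(q-1)$, the generalized Reed–Muller code $RM_L(\nu,m)$ is the set of words $(P(b_\infty),P(b_0),\dots,P(b_{n-1}))$, where $P\in L[x_1,\dots,x_m]$ has total degree at most $\nu$ and degree at most $q-1$ in each variable. Then: 1. $\mathcal K^-=\{\varepsilon 1^n+v^{(\lambda)}\mid \varepsilon\in L,\ \lambda\in\mathcal R\}$, where $1^n$ is the all-one word of length $n$ and $v^{(\lambda)}=(T(\lambda),T(\lambda\xi),\dots,T(\lambda\xi^{n-1}))$; 2. $\mathcal K=\{\varepsilon 1^{n+1}+u^{(\lambda)}\mid \varepsilon\in L,\ \lambda\in\mathcal R\}$, where $u^{(\lambda)}=(0,T(\lambda),T(\lambda\xi),\dots,T(\lambda\xi^{n-1}))$; 3. $\mathcal K=RM_L(1,m)$.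 -/

import Mathlib

open Polynomial

noncomputable section

namespace GaloisCode

/-- `L` is the Galois ring `GR(p^s, r)`: a commutative local ring whose maximal ideal is generated
by `p`, of characteristic `p^s` and of cardinality `p^(s r)`. (For `p` prime and `s, r ≥ 1` these
properties determine the ring up to isomorphism.) -/
structure IsGaloisRing (p s r : ℕ) (L : Type*) [CommRing L] : Prop where
  isLocalRing : IsLocalRing L
  maximalIdeal_eq : IsLocalRing.maximalIdeal L = Ideal.span {(p : L)}
  charP : CharP L (p ^ s)
  card_eq : Nat.card L = p ^ (s * r)

/-- A polynomial over a finite field `F` is primitive (in the sense of finite field theory) when it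
is irreducible and its root has multiplicative order `|F|^deg - 1`. -/
def IsPrimitivePolynomial {F : Type*} [CommRing F] (f : F[X]) : Prop :=
  Irreducible f ∧ orderOf (AdjoinRoot.root f) = Nat.card F ^ f.natDegree - 1

/-- A monic polynomial over a Galois ring of residue characteristic `p` is basic primitive when its
reduction modulo `p` is a primitive polynomial over the residue field `L / pL`. -/
def IsMonicBasicPrimitive {L : Type*} [CommRing L] (p : ℕ) (h : L[X]) : Prop :=
  h.Monic ∧ IsPrimitivePolynomial (h.map (Ideal.Quotient.mk (Ideal.span {(p : L)})))

section Codes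

variable {L : Type*} [CommRing L]

/-- The polynomial `c_0 + c_1 x + ⋯ + c_{n-1} x^{n-1}` of a word of length `n`. -/
def wordPoly (L : Type*) [CommRing L] (n : ℕ) : (Fin n → L) →ₗ[L] L[X] :=
  ∑ i : Fin n, (Polynomial.monomial (i : ℕ)).comp (LinearMap.proj i)

/-- The cyclic code of length `n` with generator polynomial `g`: the words whose class in
`L[x] / (x^n - 1)` lies in the ideal generated by the class of `g`. -/
def cyclicCode (n : ℕ) (g : L[X]) : Submodule L (Fin n → L) :=
  ((Ideal.span {AdjoinRoot.mk (X ^ n - 1 : L[X]) g}).restrictScalars L).comap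
    ((AdjoinRoot.mkₐ (X ^ n - 1 : L[X])).toLinearMap ∘ₗ wordPoly L n)

/-- The reciprocal polynomial of `(x^n - 1) / ((x - 1) h(x))`. -/
def kerdockGenerator (n : ℕ) (h : L[X]) : L[X] :=
  ((X ^ n - 1) /ₘ ((X - 1) * h)).reverse

/-- The shortened Kerdock code of length `n`. -/
def shortenedKerdock (n : ℕ) (h : L[X]) : Submodule L (Fin n → L) :=
  cyclicCode n (kerdockGenerator n h)

/-- Adding an overall parity check in front of a word: the coordinates of the new word sum
to zero. -/
def parityExtend (L : Type*) [CommRing L] (n : ℕ) : (Fin n → L) →ₗ[L] (Fin (n + 1) → L) where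
  toFun c := Fin.cons (-∑ i, c i) c
  map_add' c d := by
    ext i
    refine Fin.cases ?_ (fun j => ?_) i
    · simp [Finset.sum_add_distrib, add_comm]
    · simp
  map_smul' a c := by
    ext i
    refine Fin.cases ?_ (fun j => ?_) i
    · simp [Finset.mul_sum]
    · simp

/-- The Kerdock code of length `n + 1`. -/
def kerdock (n : ℕ) (h : L[X]) : Submodule L (Fin (n + 1) → L) :=
  (shortenedKerdock n h).map (parityExtend L n)

end Codes

section Extension

variable (L : Type*) {R : Type*} [CommRing L] [CommRing R] [Algebra L R]

/-- The coordinates of `x` in the basis `1, ξ, …, ξ^(m-1)` of `R` over `L`. -/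
def coord (m : ℕ) (ξ x : R) : Fin m → L :=
  Function.invFun (Fintype.linearCombination L (fun j : Fin m => ξ ^ (j : ℕ))) x

/-- The evaluation points `b_∞ = 0, b_0, …, b_{n-1}`, where `b_i` is the coordinate vector
of `ξ^i`. -/
def evalPoint (m n : ℕ) (ξ : R) : Fin (n + 1) → Fin m → L :=
  Fin.cons 0 (fun i : Fin n => coord L m ξ (ξ ^ (i : ℕ)))

/-- The evaluation map `P ↦ (P(b_∞), P(b_0), …, P(b_{n-1}))`. -/
def ev (m n : ℕ) (ξ : R) : MvPolynomial (Fin m) L →ₗ[L] (Fin (n + 1) → L) :=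
  LinearMap.pi fun i => (MvPolynomial.aeval (evalPoint L m n ξ i)).toLinearMap

/-- The generalized Reed–Muller code of order `ν` and length `n + 1 = q^m` over `L`: the evaluations
of the polynomials of total degree at most `ν` and of degree at most `q - 1` in each variable. -/
def reedMuller (q m n : ℕ) (ξ : R) (ν : ℕ) : Submodule L (Fin (n + 1) → L) :=
  (MvPolynomial.restrictDegree (Fin m) L (q - 1) ⊓
    MvPolynomial.restrictTotalDegree (Fin m) L ν).map (ev L m n ξ)

variable {L}

/-- The set `{0, 1, ξ, …, ξ^(n-1)}`. -/
def teichmullerSet (n : ℕ) (ξ : R) : Set R :=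
  insert 0 {x | ∃ i < n, x = ξ ^ i}

instance teichmullerSet_nonempty (n : ℕ) (ξ : R) : Nonempty (teichmullerSet n ξ) :=
  ⟨⟨0, Set.mem_insert _ _⟩⟩

/-- The digits `ξ_0, …, ξ_{s-1} ∈ {0, 1, ξ, …, ξ^(n-1)}` of the `p`-adic representation
`c = ξ_0 + p ξ_1 + ⋯ + p^(s-1) ξ_{s-1}`. -/
def padicDigits (p s n : ℕ) (ξ c : R) : Fin s → teichmullerSet n ξ :=
  Function.invFun
    (fun d : Fin s → teichmullerSet n ξ => ∑ i : Fin s, (p : R) ^ (i : ℕ) * (d i : R)) c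

/-- The Frobenius map `∑ p^i ξ_i ↦ ∑ p^i ξ_i^q`. -/
def frob (p s q n : ℕ) (ξ c : R) : R :=
  ∑ i : Fin s, (p : R) ^ (i : ℕ) * (padicDigits p s n ξ c i : R) ^ q

variable (L)

/-- The relative trace `T(c) = c + c^f + ⋯ + c^(f^(m-1))`, as an element of `L`. -/
def relTrace (p s q m n : ℕ) (ξ c : R) : L :=
  Function.invFun (algebraMap L R) (∑ k ∈ Finset.range m, (frob p s q n ξ)^[k] c)

/-- The tuple `v^(λ) = (T(λ), T(λ ξ), …, T(λ ξ^(n-1)))`. -/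
def traceWord (p s q m n : ℕ) (ξ lam : R) : Fin n → L :=
  fun i => relTrace L p s q m n ξ (lam * ξ ^ (i : ℕ))

end Extension

end GaloisCode

end

/-! Dividing by the monic `h` identifies `R` with `L[x]/(h)`, free over `L` on the powers of `ξ`
below `m`. Separability of `x^n - 1` modulo `p` shows that `ξ^q` is again a root of `h`
(`aeval_pow_q`), so `ξ ↦ ξ^q` extends to an `L`-algebra endomorphism `φ`. It agrees with the
digitwise Frobenius, which makes `T` the `L`-linear map `∑ φ^k`; its trace form is nondegenerate
(`eq_zero_of_trace`).

The words of the shortened code are those that the reciprocal of `(x - 1)h` kills modulo `x^n - 1`.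
The all-one word and each `v^(λ)` are sums of geometric progressions whose ratios are `1` and
`ξ^(q^k)`, roots of `(x - 1)h`, so they are killed (`word_mem_shortenedKerdock`). Equality follows
by counting: `(ε, λ) ↦ ε1 + v^(λ)` is injective on a set of size `|L|^(m+1)`, and the code is no
larger (`card_shortenedKerdock_le`).

For the extended code, `∑ ξ^i = 0` makes the parity symbol of `v^(λ)` zero, and `n = -1` in `L`
(from `s ≤ rm`) makes that of `ε1` equal to `ε`. Finally `x ↦ T(λx)` is a linear form in the
coordinates of `x`, and nondegeneracy yields every linear form, so these words are the evaluations
of affine polynomials. -/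

namespace GaloisCode

/-! ### Galois rings: powers of `p` and `p`-adic digits. -/

namespace IsGaloisRing

variable {p s t : ℕ} {A : Type*} [CommRing A]

theorem isUnit_or_dvd (hA : IsGaloisRing p s t A) (x : A) : IsUnit x ∨ (p : A) ∣ x := by
  have := hA.isLocalRing
  by_cases hx : IsUnit x
  · exact Or.inl hx
  · right
    rw [← Ideal.mem_span_singleton, ← hA.maximalIdeal_eq]
    exact (IsLocalRing.mem_maximalIdeal x).2 hx

theorem not_isUnit_of_dvd (hA : IsGaloisRing p s t A) {x : A} (hx : (p : A) ∣ x) :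
    ¬ IsUnit x := by
  have := hA.isLocalRing
  rw [← Ideal.mem_span_singleton, ← hA.maximalIdeal_eq] at hx
  exact (IsLocalRing.mem_maximalIdeal x).1 hx

theorem isUnit_one_sub (hA : IsGaloisRing p s t A) {x : A} (hx : (p : A) ∣ x) :
    IsUnit (1 - x) := by
  rcases hA.isUnit_or_dvd (1 - x) with h | h
  · exact h
  · exact absurd isUnit_one (hA.not_isUnit_of_dvd (by simpa using dvd_add h hx))

theorem isMaximal (hA : IsGaloisRing p s t A) : (Ideal.span {(p : A)}).IsMaximal := by
  have := hA.isLocalRing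
  rw [← hA.maximalIdeal_eq]
  infer_instance

theorem pow_eq_zero (hA : IsGaloisRing p s t A) : (p : A) ^ s = 0 := by
  have := hA.charP
  exact_mod_cast CharP.cast_eq_zero A (p ^ s)

theorem pow_eq_zero_of_le (hA : IsGaloisRing p s t A) {i : ℕ} (hi : s ≤ i) :
    (p : A) ^ i = 0 := by
  rw [← Nat.add_sub_of_le hi, pow_add, hA.pow_eq_zero, zero_mul]

theorem pow_ne_zero (hA : IsGaloisRing p s t A) (hp : p.Prime) {i : ℕ} (hi : i < s) :
    (p : A) ^ i ≠ 0 := by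
  have := hA.charP
  intro h
  have h' : ((p ^ i : ℕ) : A) = 0 := by exact_mod_cast h
  rw [CharP.cast_eq_zero_iff A (p ^ s), Nat.pow_dvd_pow_iff_le_right hp.one_lt] at h'
  omega

theorem finite (hA : IsGaloisRing p s t A) (hp : p.Prime) : Finite A :=
  Nat.finite_of_card_ne_zero (by rw [hA.card_eq]; exact (pow_pos hp.pos _).ne')

/-- A unit `x` would give `p^i = p^(i+1) c`, so `p^i (1 - pc) = 0` with `1 - pc` a unit,
contradicting `p^i ≠ 0`. -/
theorem dvd_of_pow_succ_dvd (hA : IsGaloisRing p s t A) (hp : p.Prime) {i : ℕ} (hi : i < s)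
    {x : A} (h : (p : A) ^ (i + 1) ∣ (p : A) ^ i * x) : (p : A) ∣ x := by
  rcases hA.isUnit_or_dvd x with hx | hx
  · exfalso
    have h1 : (p : A) ^ (i + 1) ∣ (p : A) ^ i := hx.dvd_mul_right.1 h
    obtain ⟨c, hc⟩ := h1
    have h2 : (p : A) ^ i * (1 - p * c) = 0 := by linear_combination hc
    exact hA.pow_ne_zero hp hi ((hA.isUnit_one_sub (Dvd.intro c rfl)).mul_left_eq_zero.1 h2)
  · exact hx

section Digits

variable {D : Set A}

theorem exists_digits (hD : ∀ x : A, ∃ d : D, (p : A) ∣ x - d) (j : ℕ) (c : A) :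
    ∃ (d : ℕ → D), (p : A) ^ j ∣ c - ∑ i ∈ Finset.range j, (p : A) ^ i * (d i : A) := by
  induction j generalizing c with
  | zero =>
    obtain ⟨d, -⟩ := hD 0
    exact ⟨fun _ => d, by simp⟩
  | succ j ih =>
    obtain ⟨d, hd⟩ := hD c
    obtain ⟨c', hc'⟩ := hd
    obtain ⟨e, he⟩ := ih c'
    -- The digit of `c` modulo `p` is placed before the digits of `c' = (c - d)/p`.
    refine ⟨fun i => Nat.casesOn i d e, ?_⟩
    rw [Finset.sum_range_succ']
    obtain ⟨w, hw⟩ := he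
    refine ⟨w, ?_⟩
    simp only [pow_zero, one_mul, pow_succ', mul_assoc, ← Finset.mul_sum]
    linear_combination hc' + (p : A) * hw

theorem digits_unique (hA : IsGaloisRing p s t A) (hp : p.Prime)
    (hD : ∀ d e : D, (p : A) ∣ (d : A) - e → d = e) {j : ℕ} (hj : j ≤ s) (d e : ℕ → D)
    (h : (p : A) ^ j ∣ ∑ i ∈ Finset.range j, (p : A) ^ i * (d i : A) -
      ∑ i ∈ Finset.range j, (p : A) ^ i * (e i : A)) : ∀ i < j, d i = e i := by
  induction j with
  | zero => intro i hi; omega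
  | succ j ih =>
    have h1 : ∀ i < j, d i = e i := by
      apply ih (by omega)
      have h2 := (pow_dvd_pow (p : A) (Nat.le_succ j)).trans h
      rw [Finset.sum_range_succ, Finset.sum_range_succ] at h2
      have h3 : (p : A) ^ j ∣ (p : A) ^ j * (d j - e j : A) := Dvd.intro _ rfl
      convert dvd_sub h2 h3 using 1
      ring
    intro i hi
    rcases Nat.lt_succ_iff_lt_or_eq.1 hi with hi | rfl
    · exact h1 i hi
    · apply hD
      apply hA.dvd_of_pow_succ_dvd hp hj
      rw [Finset.sum_range_succ, Finset.sum_range_succ,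
        Finset.sum_congr rfl (fun k hk => by rw [h1 k (Finset.mem_range.1 hk)])] at h
      convert h using 1
      ring

theorem digits_bijective (hA : IsGaloisRing p s t A) (hp : p.Prime)
    (hsurj : ∀ x : A, ∃ d : D, (p : A) ∣ x - d)
    (hinj : ∀ d e : D, (p : A) ∣ (d : A) - e → d = e) :
    Function.Bijective (fun d : Fin s → D => ∑ i : Fin s, (p : A) ^ (i : ℕ) * (d i : A)) := by
  obtain ⟨d₀, -⟩ := hsurj 0
  constructor
  · intro d e hde
    have key := hA.digits_unique hp hinj le_rfl (fun i => if hi : i < s then d ⟨i, hi⟩ else d₀)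
      (fun i => if hi : i < s then e ⟨i, hi⟩ else d₀) (by
        rw [← Fin.sum_univ_eq_sum_range
            (fun i => (p : A) ^ i * ((if hi : i < s then d ⟨i, hi⟩ else d₀ : D) : A)),
          ← Fin.sum_univ_eq_sum_range
            (fun i => (p : A) ^ i * ((if hi : i < s then e ⟨i, hi⟩ else d₀ : D) : A))]
        simp only [Fin.is_lt, dif_pos, Fin.eta]
        simp only at hde
        rw [hde, sub_self]
        exact dvd_zero _)
    funext i
    simpa using key i i.2
  · intro c
    obtain ⟨d, hd⟩ := exists_digits hsurj s c
    rw [hA.pow_eq_zero, zero_dvd_iff, sub_eq_zero] at hd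
    exact ⟨fun i => d i, by
      rw [hd]; exact Fin.sum_univ_eq_sum_range (fun i => (p : A) ^ i * (d i : A)) s⟩

end Digits

/-- Digits taken from any system `D` of residue representatives give `|A| = |D|^s`; comparison with
`p^(st)` and injectivity of the `s`-th power give `|D|`. -/
theorem card_quotient (hA : IsGaloisRing p s t A) (hp : p.Prime) (hs : 1 ≤ s) :
    Nat.card (A ⧸ Ideal.span {(p : A)}) = p ^ t := by
  let D : Set A := Set.range (Quotient.out : A ⧸ Ideal.span {(p : A)} → A)
  have hmk : ∀ x y : A, (p : A) ∣ x - y ↔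
      Ideal.Quotient.mk (Ideal.span {(p : A)}) x = Ideal.Quotient.mk _ y := by
    intro x y
    rw [Ideal.Quotient.eq, Ideal.mem_span_singleton]
  have hout : ∀ x : A ⧸ Ideal.span {(p : A)},
      Ideal.Quotient.mk (Ideal.span {(p : A)}) (Quotient.out x) = x := fun x => Quotient.out_eq x
  have hb : Function.Bijective
      (fun d : Fin s → D => ∑ i : Fin s, (p : A) ^ (i : ℕ) * (d i : A)) := by
    apply hA.digits_bijective hp
    · intro x
      refine ⟨⟨_, Ideal.Quotient.mk _ x, rfl⟩, ?_⟩
      rw [hmk, hout]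
    · rintro ⟨_, x, rfl⟩ ⟨_, y, rfl⟩ h
      rw [hmk, hout, hout] at h
      rw [h]
  have hD : Nat.card D = Nat.card (A ⧸ Ideal.span {(p : A)}) :=
    Nat.card_range_of_injective (fun x y hxy => by rw [← hout x, hxy, hout])
  have := Nat.card_eq_of_bijective _ hb
  rw [hA.card_eq, Nat.card_fun, hD, Nat.card_fin, mul_comm, pow_mul] at this
  exact Nat.pow_left_injective (by omega : s ≠ 0) this

end IsGaloisRing

end GaloisCode

/-! ### The extension generated by `ξ`: Teichmüller digits, basis and Frobenius. -/

namespace GaloisCode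

/-- Evaluation at `β` is a map out of the field `k[x]/(f)`, hence injective, so it preserves orders
even if `K` is not a field. -/
theorem orderOf_eq_orderOf_root {k K : Type*} [Field k] [CommRing K] [Nontrivial K] (ι : k →+* K)
    {f : k[X]} (hf : Irreducible f) {β : K} (hβ : f.eval₂ ι β = 0) :
    orderOf β = orderOf (AdjoinRoot.root f) := by
  have : Fact (Irreducible f) := ⟨hf⟩
  have hinj : Function.Injective (AdjoinRoot.lift ι β hβ) := RingHom.injective _
  have := orderOf_injective (AdjoinRoot.lift ι β hβ : AdjoinRoot f →* K) hinj (AdjoinRoot.root f)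
  rw [← this]
  simp

/-- Over a field of `q` elements, `f(x^q) = f(x)^q`. -/
theorem eval₂_pow_card_eq_zero {k K : Type*} [Field k] [Finite k] [CommRing K] (ι : k →+* K)
    {f : k[X]} {β : K} (hβ : f.eval₂ ι β = 0) : f.eval₂ ι (β ^ Nat.card k) = 0 := by
  have := Fintype.ofFinite k
  have h := congrArg (eval₂ ι β) (FiniteField.expand_card f)
  rw [expand_eq_comp_X_pow, eval₂_comp, eval₂_pow, eval₂_pow, eval₂_X, hβ, zero_pow Fintype.card_ne_zero] at h
  rwa [Nat.card_eq_fintype_card]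

theorem pow_eq_pow_iff_of_isUnit {M : Type*} [Monoid M] {x : M} (hx : IsUnit x) {i j : ℕ} :
    x ^ i = x ^ j ↔ i ≡ j [MOD orderOf x] := by
  obtain ⟨u, rfl⟩ := hx
  rw [orderOf_units, ← pow_eq_pow_iff_modEq, ← Units.val_pow_eq_pow_val,
    ← Units.val_pow_eq_pow_val, Units.val_inj]

/-- The standing hypotheses on a Galois ring extension `R / L` with a primitive element `ξ`. -/
structure KerdockSetting (p s r m q n : ℕ) {L R : Type*} [CommRing L] [CommRing R] [Algebra L R]
    (h : L[X]) (ξ : R) : Prop where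
  prime : p.Prime
  one_le_s : 1 ≤ s
  one_le_r : 1 ≤ r
  one_le_m : 1 ≤ m
  s_le : s ≤ r * m
  q_eq : q = p ^ r
  n_eq : n = q ^ m - 1
  ne_two : q ^ m ≠ 2
  base : IsGaloisRing p s r L
  ext : IsGaloisRing p s (r * m) R
  primitive : IsMonicBasicPrimitive p h
  natDegree_eq : h.natDegree = m
  dvd : h ∣ X ^ n - 1
  aeval_eq_zero : aeval ξ h = 0
  orderOf_eq : orderOf ξ = n

namespace KerdockSetting

variable {p s r m q n : ℕ} {L R : Type*} [CommRing L] [CommRing R] [Algebra L R]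
  {h : L[X]} {ξ : R}

theorem two_le_q (S : KerdockSetting p s r m q n h ξ) : 2 ≤ q := by
  rw [S.q_eq]
  exact S.prime.two_le.trans (Nat.le_self_pow (by have := S.one_le_r; omega) p)

theorem q_le (S : KerdockSetting p s r m q n h ξ) : q ≤ q ^ m :=
  Nat.le_self_pow (by have := S.one_le_m; omega) q

theorem n_add_one (S : KerdockSetting p s r m q n h ξ) : n + 1 = q ^ m := by
  have h1 := S.two_le_q
  have h2 := S.q_le
  have h3 := S.n_eq
  omega

theorem two_le_n (S : KerdockSetting p s r m q n h ξ) : 2 ≤ n := by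
  have h1 := S.two_le_q
  have h2 := S.q_le
  have h3 := S.n_add_one
  have h4 := S.ne_two
  omega

theorem nontrivial (S : KerdockSetting p s r m q n h ξ) : Nontrivial R := by
  have := S.ext.isLocalRing
  infer_instance

theorem nontrivial_base (S : KerdockSetting p s r m q n h ξ) : Nontrivial L := by
  have := S.base.isLocalRing
  infer_instance

theorem finite (S : KerdockSetting p s r m q n h ξ) : Finite R := S.ext.finite S.prime

theorem finite_base (S : KerdockSetting p s r m q n h ξ) : Finite L := S.base.finite S.prime

theorem card_eq_pow (S : KerdockSetting p s r m q n h ξ) : Nat.card R = Nat.card L ^ m := by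
  rw [S.ext.card_eq, S.base.card_eq, ← pow_mul, mul_assoc]

theorem pow_card_eq (S : KerdockSetting p s r m q n h ξ) : q ^ m = p ^ (r * m) := by
  rw [S.q_eq, pow_mul]

theorem cast_n (S : KerdockSetting p s r m q n h ξ) : (n : R) = -1 := by
  have h1 := congrArg (Nat.cast : ℕ → R) (S.n_add_one.trans S.pow_card_eq)
  push_cast at h1
  rw [S.ext.pow_eq_zero_of_le S.s_le] at h1
  exact eq_neg_of_add_eq_zero_left h1

theorem cast_n_base (S : KerdockSetting p s r m q n h ξ) : (n : L) = -1 := by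
  have h1 := congrArg (Nat.cast : ℕ → L) (S.n_add_one.trans S.pow_card_eq)
  push_cast at h1
  rw [S.base.pow_eq_zero_of_le S.s_le] at h1
  exact eq_neg_of_add_eq_zero_left h1

theorem pow_n (S : KerdockSetting p s r m q n h ξ) : ξ ^ n = 1 := by
  rw [← S.orderOf_eq, pow_orderOf_eq_one]

theorem isUnit (S : KerdockSetting p s r m q n h ξ) : IsUnit ξ :=
  IsUnit.of_pow_eq_one S.pow_n (by have := S.two_le_n; omega)

theorem pow_pow_m (S : KerdockSetting p s r m q n h ξ) : ξ ^ q ^ m = ξ := by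
  rw [← S.n_add_one, pow_succ, S.pow_n, one_mul]

/-- The map of residue fields induced by the structure map of `R` over `L`. -/
def residueMap (p : ℕ) (L R : Type*) [CommRing L] [CommRing R] [Algebra L R] :
    L ⧸ Ideal.span {(p : L)} →+* R ⧸ Ideal.span {(p : R)} :=
  Ideal.quotientMap _ (algebraMap L R) (by
    rw [Ideal.span_singleton_le_iff_mem, Ideal.mem_comap, map_natCast]
    exact Ideal.mem_span_singleton_self _)

theorem eval₂_residueMap (f : L[X]) (x : R) :
    (f.map (Ideal.Quotient.mk (Ideal.span {(p : L)}))).eval₂ (residueMap p L R)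
      (Ideal.Quotient.mk _ x) = Ideal.Quotient.mk _ (aeval x f) := by
  rw [eval₂_map, aeval_def, hom_eval₂]
  congr 1

theorem mk_eq_iff (x y : R) : Ideal.Quotient.mk (Ideal.span {(p : R)}) x = Ideal.Quotient.mk _ y ↔
    (p : R) ∣ x - y := by
  rw [Ideal.Quotient.eq, Ideal.mem_span_singleton]

theorem card_residue (S : KerdockSetting p s r m q n h ξ) :
    Nat.card (R ⧸ Ideal.span {(p : R)}) = q ^ m := by
  rw [S.ext.card_quotient S.prime S.one_le_s, S.pow_card_eq]

theorem card_residue_base (S : KerdockSetting p s r m q n h ξ) :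
    Nat.card (L ⧸ Ideal.span {(p : L)}) = q := by
  rw [S.base.card_quotient S.prime S.one_le_s, S.q_eq]

theorem nontrivial_residue (S : KerdockSetting p s r m q n h ξ) :
    Nontrivial (R ⧸ Ideal.span {(p : R)}) :=
  Ideal.Quotient.nontrivial_iff.2 S.ext.isMaximal.ne_top

theorem orderOf_mk (S : KerdockSetting p s r m q n h ξ) :
    orderOf (Ideal.Quotient.mk (Ideal.span {(p : R)}) ξ) = n := by
  have := S.base.isMaximal
  have := S.nontrivial_residue
  have := S.nontrivial_base
  let _ := Ideal.Quotient.field (Ideal.span {(p : L)})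
  rw [orderOf_eq_orderOf_root (residueMap p L R) S.primitive.2.1
    (by rw [eval₂_residueMap, S.aeval_eq_zero, map_zero]), S.primitive.2.2,
    S.primitive.1.natDegree_map, S.natDegree_eq, S.card_residue_base, S.n_eq]

theorem dvd_aeval_pow (S : KerdockSetting p s r m q n h ξ) : (p : R) ∣ aeval (ξ ^ q) h := by
  have := S.base.isMaximal
  have := S.finite_base
  let _ := Ideal.Quotient.field (Ideal.span {(p : L)})
  have hf : Finite (L ⧸ Ideal.span {(p : L)}) := Quotient.finite _
  have h1 := eval₂_pow_card_eq_zero (residueMap p L R)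
    (f := h.map (Ideal.Quotient.mk (Ideal.span {(p : L)})))
    (β := Ideal.Quotient.mk _ ξ) (by rw [eval₂_residueMap, S.aeval_eq_zero, map_zero])
  rw [S.card_residue_base, ← map_pow, eval₂_residueMap] at h1
  rwa [Ideal.Quotient.eq_zero_iff_mem, Ideal.mem_span_singleton] at h1

/-- A Hensel-type argument. Write `x^n - 1 = h g`; then `h(ξ^q) g(ξ^q) = 0` and `p` divides
`h(ξ^q)`. If `p` also divided `g(ξ^q)`, it would divide the derivative `n (ξ^q)^(n-1)`, a unit since
`n = -1`. So `g(ξ^q)` is a unit and can be cancelled. -/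
theorem aeval_pow_q (S : KerdockSetting p s r m q n h ξ) : aeval (ξ ^ q) h = 0 := by
  obtain ⟨g, hg⟩ := S.dvd
  have hα : (ξ ^ q) ^ n = 1 := by rw [pow_right_comm, S.pow_n, one_pow]
  have h1 : aeval (ξ ^ q) h * aeval (ξ ^ q) g = 0 := by
    rw [← map_mul, ← hg]
    simp [hα]
  have h2 : (n : R) * (ξ ^ q) ^ (n - 1) =
      aeval (ξ ^ q) (derivative h) * aeval (ξ ^ q) g +
        aeval (ξ ^ q) h * aeval (ξ ^ q) (derivative g) := by
    have := congrArg (fun f => aeval (ξ ^ q) (derivative f)) hg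
    simpa [derivative_mul, derivative_X_pow] using this
  rcases S.ext.isUnit_or_dvd (aeval (ξ ^ q) g) with hu | hu
  · exact hu.mul_left_eq_zero.1 h1
  · exfalso
    refine S.ext.not_isUnit_of_dvd (x := (n : R) * (ξ ^ q) ^ (n - 1)) ?_ ?_
    · rw [h2]
      exact dvd_add (hu.mul_left _) (S.dvd_aeval_pow.mul_right _)
    · rw [S.cast_n]
      exact isUnit_one.neg.mul ((S.isUnit.pow q).pow _)

theorem pow_mem_teichmullerSet (S : KerdockSetting p s r m q n h ξ) (i : ℕ) :
    ξ ^ i ∈ teichmullerSet n ξ := by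
  refine Set.mem_insert_of_mem _ ⟨i % n, Nat.mod_lt _ (by have := S.two_le_n; omega), ?_⟩
  rw [← S.orderOf_eq, pow_mod_orderOf]

theorem teichmuller_cases {x : R} (hx : x ∈ teichmullerSet n ξ) : x = 0 ∨ ∃ i, x = ξ ^ i := by
  rcases hx with rfl | ⟨i, -, rfl⟩
  · exact Or.inl rfl
  · exact Or.inr ⟨i, rfl⟩

/-- Reduction modulo `p` does not shorten the order of `ξ`, because the reduction of `h` is
primitive. -/
theorem teichmuller_inj (S : KerdockSetting p s r m q n h ξ) (d e : teichmullerSet n ξ)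
    (hde : (p : R) ∣ (d : R) - e) : d = e := by
  have := S.nontrivial_residue
  have hu : ∀ i, Ideal.Quotient.mk (Ideal.span {(p : R)}) (ξ ^ i) ≠ 0 := fun i =>
    ((S.isUnit.pow i).map _).ne_zero
  rw [← mk_eq_iff] at hde
  obtain ⟨d, hd⟩ := d
  obtain ⟨e, he⟩ := e
  rw [Subtype.mk.injEq]
  rcases teichmuller_cases hd with rfl | ⟨i, rfl⟩ <;>
  rcases teichmuller_cases he with rfl | ⟨j, rfl⟩
  · rfl
  · exact absurd (hde.symm.trans (map_zero _)) (hu j)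
  · exact absurd (hde.trans (map_zero _)) (hu i)
  · simp only [map_pow] at hde
    rw [pow_eq_pow_iff_of_isUnit (S.isUnit.map _), S.orderOf_mk] at hde
    rw [pow_eq_pow_iff_of_isUnit S.isUnit, S.orderOf_eq]
    exact hde

/-- The `n + 1` elements `0, 1, …, ξ^(n-1)` are pairwise incongruent modulo `p`, and the residue
field has exactly `q^m = n + 1` elements. -/
theorem teichmuller_surj (S : KerdockSetting p s r m q n h ξ) (x : R) :
    ∃ d : teichmullerSet n ξ, (p : R) ∣ x - d := by
  have := S.nontrivial
  have := S.finite
  have : Finite (R ⧸ Ideal.span {(p : R)}) := Quotient.finite _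
  let f : Option (Fin n) → teichmullerSet n ξ := fun o =>
    o.elim ⟨0, Set.mem_insert _ _⟩ fun i => ⟨ξ ^ (i : ℕ), S.pow_mem_teichmullerSet i⟩
  have hf : Function.Injective f := by
    rintro (_ | i) (_ | j) hij
    · rfl
    · exact absurd (congrArg Subtype.val hij).symm (S.isUnit.pow j).ne_zero
    · exact absurd (congrArg Subtype.val hij) (S.isUnit.pow i).ne_zero
    · have h1 : ξ ^ (i : ℕ) = ξ ^ (j : ℕ) := congrArg Subtype.val hij
      rw [pow_eq_pow_iff_of_isUnit S.isUnit, S.orderOf_eq, Nat.ModEq, Nat.mod_eq_of_lt i.2, Nat.mod_eq_of_lt j.2] at h1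
      rw [Fin.ext h1]
  have hb : Function.Bijective
      (fun o => Ideal.Quotient.mk (Ideal.span {(p : R)}) (f o : R)) := by
    rw [Nat.bijective_iff_injective_and_card]
    refine ⟨fun o o' ho => hf (S.teichmuller_inj _ _ ((mk_eq_iff _ _).1 ho)), ?_⟩
    rw [S.card_residue, ← S.n_add_one]
    simp
  obtain ⟨o, ho⟩ := hb.2 (Ideal.Quotient.mk _ x)
  exact ⟨f o, (mk_eq_iff _ _).1 ho.symm⟩

theorem digits_bijective (S : KerdockSetting p s r m q n h ξ) : Function.Bijective
    (fun d : Fin s → teichmullerSet n ξ => ∑ i : Fin s, (p : R) ^ (i : ℕ) * (d i : R)) :=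
  S.ext.digits_bijective S.prime S.teichmuller_surj S.teichmuller_inj

theorem aeval_surjective (S : KerdockSetting p s r m q n h ξ) :
    Function.Surjective (aeval ξ : L[X] →ₐ[L] R) := by
  intro x
  obtain ⟨d, rfl⟩ := S.digits_bijective.2 x
  have hd : ∀ i, ∃ f : L[X], aeval ξ f = (d i : R) := by
    intro i
    rcases teichmuller_cases (d i).2 with h0 | ⟨j, hj⟩
    · exact ⟨0, by rw [h0, map_zero]⟩
    · exact ⟨X ^ j, by rw [hj]; simp⟩
  choose f hf using hd
  exact ⟨∑ i : Fin s, (p : L[X]) ^ (i : ℕ) * f i, by simp [hf]⟩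

/-- Remainders modulo `h` have degree below `m`, which gives surjectivity; both sides have `|L|^m`
elements. -/
theorem linearCombination_bijective (S : KerdockSetting p s r m q n h ξ) :
    Function.Bijective (Fintype.linearCombination L (fun j : Fin m => ξ ^ (j : ℕ))) := by
  have := S.finite_base
  have := S.nontrivial_base
  rw [Nat.bijective_iff_surjective_and_card]
  constructor
  · intro x
    obtain ⟨f, rfl⟩ := S.aeval_surjective x
    rw [← aeval_modByMonic_eq_self_of_root S.aeval_eq_zero (p := f)]
    refine ⟨fun j => (f %ₘ h).coeff j, ?_⟩
    have hlt : (f %ₘ h).natDegree < m := by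
      rw [← S.natDegree_eq]
      refine natDegree_modByMonic_lt f S.primitive.1 ?_
      rintro rfl
      exact absurd (natDegree_one.symm.trans S.natDegree_eq) (by have := S.one_le_m; omega)
    rw [aeval_eq_sum_range' hlt, Fintype.linearCombination_apply,
      ← Fin.sum_univ_eq_sum_range (fun i => (f %ₘ h).coeff i • ξ ^ i)]
  · rw [Nat.card_fun, Nat.card_fin, S.card_eq_pow]

theorem linearMap_ext (S : KerdockSetting p s r m q n h ξ) {M : Type*} [AddCommMonoid M]
    [Module L M] {f g : R →ₗ[L] M} (hfg : ∀ j : Fin m, f (ξ ^ (j : ℕ)) = g (ξ ^ (j : ℕ))) :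
    f = g := by
  ext x
  obtain ⟨a, rfl⟩ := S.linearCombination_bijective.2 x
  simp [Fintype.linearCombination_apply, hfg]

theorem dvd_of_aeval_eq_zero (S : KerdockSetting p s r m q n h ξ) {f : L[X]}
    (hf : aeval ξ f = 0) : h ∣ f := by
  have := S.nontrivial_base
  rw [← modByMonic_eq_zero_iff_dvd S.primitive.1]
  have hlt : (f %ₘ h).natDegree < m := by
    rw [← S.natDegree_eq]
    refine natDegree_modByMonic_lt f S.primitive.1 ?_
    rintro rfl
    exact absurd (natDegree_one.symm.trans S.natDegree_eq) (by have := S.one_le_m; omega)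
  have h0 : (fun j : Fin m => (f %ₘ h).coeff j) = 0 := by
    apply S.linearCombination_bijective.1
    rw [map_zero, Fintype.linearCombination_apply,
      Fin.sum_univ_eq_sum_range (fun i => (f %ₘ h).coeff i • ξ ^ i), ← aeval_eq_sum_range' hlt,
      aeval_modByMonic_eq_self_of_root S.aeval_eq_zero, hf]
  ext i
  by_cases hi : i < m
  · exact congrFun h0 ⟨i, hi⟩
  · rw [coeff_eq_zero_of_natDegree_lt (by omega), coeff_zero]

theorem algebraMap_injective (S : KerdockSetting p s r m q n h ξ) :
    Function.Injective (algebraMap L R) := by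
  rw [injective_iff_map_eq_zero]
  intro a ha
  have := S.nontrivial_base
  by_contra hne
  have h1 := S.dvd_of_aeval_eq_zero (f := C a) (by rw [aeval_C, ha])
  have h2 := S.primitive.1.not_dvd_of_natDegree_lt (C_ne_zero.2 hne)
    (by rw [natDegree_C, S.natDegree_eq]; have := S.one_le_m; omega)
  exact h2 h1

/-- The kernel of evaluation at `ξ` is generated by `h`, which vanishes at `ξ^q`, so evaluation at
`ξ^q` factors through `R`. -/
theorem exists_frobenius (S : KerdockSetting p s r m q n h ξ) :
    ∃ φ : R →ₐ[L] R, φ ξ = ξ ^ q := by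
  let f : L[X] →ₐ[L] R := aeval ξ
  let g : L[X] →ₐ[L] R := aeval (ξ ^ q)
  have hker : ∀ a : L[X], a ∈ RingHom.ker f → g a = 0 := by
    intro a ha
    obtain ⟨b, rfl⟩ := S.dvd_of_aeval_eq_zero ha
    rw [map_mul, show g h = 0 from S.aeval_pow_q, zero_mul]
  let e := Ideal.quotientKerAlgEquivOfSurjective (f := f) S.aeval_surjective
  refine ⟨(Ideal.Quotient.liftₐ (RingHom.ker f) g hker).comp e.symm.toAlgHom, ?_⟩
  have : e.symm ξ = Ideal.Quotient.mk _ X := by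
    rw [AlgEquiv.symm_apply_eq]
    simp [e, f]
  refine (congrArg (Ideal.Quotient.liftₐ (RingHom.ker f) g hker) this).trans ?_
  exact (Ideal.Quotient.lift_mk _ _ _).trans (aeval_X _)

end KerdockSetting

end GaloisCode

/-! ### The trace: values in `L`, linearity and nondegeneracy. -/

namespace GaloisCode

/-- Otherwise `x` and the image of `k` would be `|k| + 1` roots of `X^|k| - X`. -/
theorem mem_range_of_pow_card_eq {k K : Type*} [Field k] [Finite k] [Field K]
    (ι : k →+* K) {x : K} (hx : x ^ Nat.card k = x) : ∃ a, ι a = x := by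
  have := Fintype.ofFinite k
  rw [Nat.card_eq_fintype_card] at hx
  by_contra! hno
  refine FiniteField.X_pow_card_sub_X_ne_zero K (Fintype.one_lt_card (α := k))
    (eq_zero_of_natDegree_lt_card_of_eval_eq_zero _ (f := fun o : Option k => o.elim x ι) ?_ ?_ ?_)
  · rintro (_ | a) (_ | b) hab
    · rfl
    · exact absurd hab.symm (hno b)
    · exact absurd hab (hno a)
    · rw [ι.injective hab]
  · rintro (_ | a)
    · simp [hx]
    · simp [← map_pow, FiniteField.pow_card]
  · rw [FiniteField.X_pow_card_sub_X_natDegree_eq K Fintype.one_lt_card, Fintype.card_option]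
    exact Nat.lt_succ_self _

namespace KerdockSetting

variable {p s r m q n : ℕ} {L R : Type*} [CommRing L] [CommRing R] [Algebra L R]
  {h : L[X]} {ξ : R}

theorem algHom_ext (S : KerdockSetting p s r m q n h ξ) {φ ψ : R →ₐ[L] R} (hφ : φ ξ = ψ ξ) :
    φ = ψ := by
  ext x
  obtain ⟨f, rfl⟩ := S.aeval_surjective x
  rw [← aeval_algHom_apply, ← aeval_algHom_apply, hφ]

theorem pow_apply {φ : R →ₐ[L] R} (hφ : φ ξ = ξ ^ q) (k : ℕ) : (φ ^ k) ξ = ξ ^ q ^ k := by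
  induction k with
  | zero => simp
  | succ k ih => rw [pow_succ', AlgHom.mul_apply, ih, map_pow, hφ, ← pow_mul, pow_succ']

theorem pow_apply_teichmuller (S : KerdockSetting p s r m q n h ξ) {φ : R →ₐ[L] R}
    (hφ : φ ξ = ξ ^ q) (k : ℕ) {x : R} (hx : x ∈ teichmullerSet n ξ) :
    (φ ^ k) x = x ^ q ^ k := by
  rcases teichmuller_cases hx with rfl | ⟨i, rfl⟩
  · rw [map_zero, zero_pow]
    have := S.two_le_q
    positivity
  · rw [map_pow, pow_apply hφ, pow_right_comm]

theorem sum_padicDigits (S : KerdockSetting p s r m q n h ξ) (c : R) :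
    ∑ i : Fin s, (p : R) ^ (i : ℕ) * (padicDigits p s n ξ c i : R) = c :=
  Function.invFun_eq (S.digits_bijective.2 c)

/-- `φ` fixes `p` and raises every Teichmüller digit to the power `q`. In particular the digitwise
map is a ring homomorphism. -/
theorem frob_eq (S : KerdockSetting p s r m q n h ξ) {φ : R →ₐ[L] R} (hφ : φ ξ = ξ ^ q) :
    frob p s q n ξ = φ := by
  funext c
  conv_rhs => rw [← S.sum_padicDigits c]
  rw [map_sum, frob]
  refine Finset.sum_congr rfl fun i _ => ?_
  have := S.pow_apply_teichmuller hφ 1 (padicDigits p s n ξ c i).2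
  rw [pow_one, pow_one] at this
  rw [map_mul, map_pow, map_natCast, this]

theorem teichmuller_pow (S : KerdockSetting p s r m q n h ξ) {x : R} (hx : x ∈ teichmullerSet n ξ)
    (k : ℕ) (hk : k ≠ 0) : x ^ k ∈ teichmullerSet n ξ := by
  rcases teichmuller_cases hx with rfl | ⟨i, rfl⟩
  · rwa [zero_pow hk]
  · rw [← pow_mul]
    exact S.pow_mem_teichmullerSet _

theorem exists_base_of_pow_eq (S : KerdockSetting p s r m q n h ξ) {t : R} (ht : t ^ q = t) :
    ∃ a : L, algebraMap L R a = t := by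
  have := S.base.isMaximal
  have := S.ext.isMaximal
  have := S.finite_base
  let _ := Ideal.Quotient.field (Ideal.span {(p : L)})
  let _ := Ideal.Quotient.field (Ideal.span {(p : R)})
  have hf : Finite (L ⧸ Ideal.span {(p : L)}) := Quotient.finite _
  obtain ⟨b, hb⟩ := mem_range_of_pow_card_eq (residueMap p L R)
    (x := Ideal.Quotient.mk _ t) (by rw [S.card_residue_base, ← map_pow, ht])
  obtain ⟨a, rfl⟩ := Ideal.Quotient.mk_surjective b
  have h1 : (p : R) ∣ algebraMap L R a - t := (mk_eq_iff _ _).1 hb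
  -- Raising `a ≡ t` modulo `p` to the power `p^(rs) = q^s` gives a congruence modulo `p^(rs+1) =
  -- 0`, hence `a^(q^s) = t^(q^s) = t`.
  have h2 := dvd_sub_pow_of_dvd_sub h1 (r * s)
  rw [S.ext.pow_eq_zero_of_le (by have := Nat.le_mul_of_pos_left s S.one_le_r; omega),
    zero_dvd_iff, sub_eq_zero, pow_mul, ← S.q_eq] at h2
  have h3 : ∀ k, t ^ q ^ k = t := by
    intro k
    induction k with
    | zero => simp
    | succ k ih => rw [pow_succ, pow_mul, ih, ht]
  exact ⟨a ^ q ^ s, by rw [map_pow, h2, h3]⟩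

/-- By uniqueness of digits, `φ c = c` forces each digit to satisfy `d^q = d`, so every digit comes
from `L`. -/
theorem exists_base_of_fixed (S : KerdockSetting p s r m q n h ξ) {φ : R →ₐ[L] R}
    (hφ : φ ξ = ξ ^ q) {c : R} (hc : φ c = c) : ∃ a : L, algebraMap L R a = c := by
  have hq0 : q ≠ 0 := by have := S.two_le_q; omega
  have h1 : (fun i => ⟨_, S.teichmuller_pow (padicDigits p s n ξ c i).2 q hq0⟩) =
      padicDigits p s n ξ c := by
    apply S.digits_bijective.1
    exact (congrFun (S.frob_eq hφ) c).trans (hc.trans (S.sum_padicDigits c).symm)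
  have h2 : ∀ i, ∃ a : L, algebraMap L R a = padicDigits p s n ξ c i := fun i =>
    S.exists_base_of_pow_eq (congrArg Subtype.val (congrFun h1 i))
  choose a ha using h2
  exact ⟨∑ i : Fin s, (p : L) ^ (i : ℕ) * a i, by
    rw [← S.sum_padicDigits c, map_sum]; simp [ha]⟩

theorem algebraMap_relTrace (S : KerdockSetting p s r m q n h ξ) {φ : R →ₐ[L] R}
    (hφ : φ ξ = ξ ^ q) (c : R) : algebraMap L R (relTrace L p s q m n ξ c) =
      ∑ k ∈ Finset.range m, (φ ^ k) c := by
  have hm : φ ^ m = 1 := S.algHom_ext (by rw [pow_apply hφ, S.pow_pow_m, AlgHom.one_apply])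
  rw [relTrace, S.frob_eq hφ]
  simp only [← AlgHom.coe_pow]
  apply Function.invFun_eq
  apply S.exists_base_of_fixed hφ
  -- Splitting `m + 1` terms off at either end, the terms `φ^m c` and `φ^0 c` agree and cancel, so
  -- the trace sum is fixed by `φ`.
  have h1 := Finset.sum_range_succ (fun k => (φ ^ k) c) m
  rw [Finset.sum_range_succ', hm, pow_zero, add_left_inj] at h1
  rw [map_sum, ← h1]
  simp only [pow_succ', AlgHom.mul_apply]

/-- The relative trace as a linear map. -/
noncomputable def trace (S : KerdockSetting p s r m q n h ξ) : R →ₗ[L] L where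
  toFun := relTrace L p s q m n ξ
  map_add' x y := by
    obtain ⟨φ, hφ⟩ := S.exists_frobenius
    apply S.algebraMap_injective
    simp [S.algebraMap_relTrace hφ, Finset.sum_add_distrib]
  map_smul' a x := by
    obtain ⟨φ, hφ⟩ := S.exists_frobenius
    apply S.algebraMap_injective
    rw [S.algebraMap_relTrace hφ, RingHom.id_apply, smul_eq_mul, map_mul,
      S.algebraMap_relTrace hφ, Finset.mul_sum]
    exact Finset.sum_congr rfl fun k _ => by rw [map_smul, Algebra.smul_def]

theorem algebraMap_trace (S : KerdockSetting p s r m q n h ξ) {φ : R →ₐ[L] R}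
    (hφ : φ ξ = ξ ^ q) (c : R) : algebraMap L R (S.trace c) = ∑ k ∈ Finset.range m, (φ ^ k) c :=
  S.algebraMap_relTrace hφ c

/-- Modulo `p` the trace is evaluation of `∑ X^(q^k)`, a nonzero polynomial of degree at most
`q^(m-1)`, which cannot vanish on all `q^m` residues. -/
theorem exists_isUnit_trace (S : KerdockSetting p s r m q n h ξ) :
    ∃ y, IsUnit (algebraMap L R (S.trace y)) := by
  obtain ⟨φ, hφ⟩ := S.exists_frobenius
  by_contra! hno
  have := S.ext.isMaximal
  have := S.finite
  have : Finite (R ⧸ Ideal.span {(p : R)}) := Quotient.finite _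
  have := Fintype.ofFinite (R ⧸ Ideal.span {(p : R)})
  let P : (R ⧸ Ideal.span {(p : R)})[X] := ∑ k ∈ Finset.range m, X ^ q ^ k
  have hP : P = 0 := by
    refine eq_zero_of_natDegree_lt_card_of_eval_eq_zero P Function.injective_id ?_ ?_
    · intro x
      obtain ⟨x, rfl⟩ := Ideal.Quotient.mk_surjective x
      obtain ⟨d, hd⟩ := S.teichmuller_surj x
      rw [← mk_eq_iff] at hd
      have h1 := (S.ext.isUnit_or_dvd _).resolve_left (hno d)
      rw [S.algebraMap_trace hφ, Finset.sum_congr rfl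
        (fun k _ => S.pow_apply_teichmuller hφ k d.2), ← Ideal.mem_span_singleton,
        ← Ideal.Quotient.eq_zero_iff_mem] at h1
      simpa [P, eval_finsetSum, hd] using h1
    · rw [← Nat.card_eq_fintype_card, S.card_residue]
      have hq := S.two_le_q
      have hm := S.one_le_m
      have h1 : P.natDegree ≤ q ^ (m - 1) := by
        refine natDegree_sum_le_of_forall_le _ _ fun k hk => ?_
        rw [natDegree_X_pow]
        have := Finset.mem_range.1 hk
        exact Nat.pow_le_pow_right (by omega) (by omega)
      exact h1.trans_lt (Nat.pow_lt_pow_right (by omega) (by omega))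
  have h1 : P.coeff 1 = 1 := by
    simp only [P, finsetSum_coeff, coeff_X_pow]
    rw [Finset.sum_eq_single_of_mem 0 (Finset.mem_range.2 S.one_le_m)]
    · simp
    · intro k _ hk
      rw [if_neg]
      exact (Nat.one_lt_pow hk (by have := S.two_le_q; omega)).ne
  rw [hP, coeff_zero] at h1
  exact zero_ne_one h1

/-- If `c = p^i u` with `u` a unit and `i < s`, then `x = u⁻¹ y` with `T(y)` a unit gives `T(cx) =
p^i T(y) ≠ 0`. Hence `c` is divisible by each `p^i` up to `p^s = 0`. -/
theorem eq_zero_of_trace (S : KerdockSetting p s r m q n h ξ) {c : R}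
    (hc : ∀ x, S.trace (c * x) = 0) : c = 0 := by
  obtain ⟨y, hy⟩ := S.exists_isUnit_trace
  have key : ∀ i ≤ s, (p : R) ^ i ∣ c := by
    intro i hi
    induction i with
    | zero => simp
    | succ i ih =>
      obtain ⟨u, rfl⟩ := ih (by omega)
      rcases S.ext.isUnit_or_dvd u with hu | ⟨v, rfl⟩
      · exfalso
        obtain ⟨v, hv⟩ := hu.exists_right_inv
        have h1 := congrArg (algebraMap L R) (hc (v * y))
        rw [show (p : R) ^ i * u * (v * y) = (p : L) ^ i • y by
          rw [Algebra.smul_def]; push_cast; linear_combination (p : R) ^ i * y * hv,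
          map_smul, smul_eq_mul, map_mul, map_pow, map_natCast, map_zero] at h1
        exact S.ext.pow_ne_zero S.prime (by omega) (hy.mul_left_eq_zero.1 h1)
      · exact ⟨v, by ring⟩
  have := key s le_rfl
  rwa [S.ext.pow_eq_zero, zero_dvd_iff] at this

theorem eq_zero_of_trace_pow (S : KerdockSetting p s r m q n h ξ) {c : R}
    (hc : ∀ j : Fin m, S.trace (c * ξ ^ (j : ℕ)) = 0) : c = 0 := by
  apply S.eq_zero_of_trace
  have : S.trace ∘ₗ LinearMap.mulLeft L c = 0 := S.linearMap_ext (fun j => by simp [hc])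
  exact fun x => LinearMap.congr_fun this x

/-- Nondegeneracy gives injectivity, and equal finite cardinalities give the rest: every `L`-linear
form is `x ↦ T(cx)`. -/
theorem exists_trace_pow_eq (S : KerdockSetting p s r m q n h ξ) (a : Fin m → L) :
    ∃ c, ∀ j : Fin m, S.trace (c * ξ ^ (j : ℕ)) = a j := by
  have := S.finite_base
  have hb : Function.Bijective (fun (c : R) (j : Fin m) => S.trace (c * ξ ^ (j : ℕ))) := by
    rw [Nat.bijective_iff_injective_and_card]
    constructor
    · intro c d hcd
      rw [← sub_eq_zero]
      apply S.eq_zero_of_trace_pow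
      intro j
      rw [sub_mul, map_sub, sub_eq_zero]
      exact congrFun hcd j
    · rw [Nat.card_fun, Nat.card_fin, S.card_eq_pow]
  obtain ⟨c, hc⟩ := hb.2 a
  exact ⟨c, congrFun hc⟩

/-- If `ξ ≡ 1` modulo `p`, the residue of `ξ` would have order `1`, whereas `q^m ≠ 2` ensures `n ≥
2`. -/
theorem isUnit_sub_one (S : KerdockSetting p s r m q n h ξ) : IsUnit (ξ - 1) := by
  refine (S.ext.isUnit_or_dvd _).resolve_right fun hd => ?_
  have h1 : Ideal.Quotient.mk (Ideal.span {(p : R)}) ξ = 1 := by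
    rw [← map_one (Ideal.Quotient.mk _), mk_eq_iff]
    exact hd
  have h2 := S.orderOf_mk
  rw [h1, orderOf_one] at h2
  have := S.two_le_n
  omega

theorem sum_pow (S : KerdockSetting p s r m q n h ξ) : ∑ i ∈ Finset.range n, ξ ^ i = 0 := by
  have h1 := geom_sum_mul ξ n
  rw [S.pow_n, sub_self] at h1
  exact S.isUnit_sub_one.mul_left_eq_zero.1 h1

end KerdockSetting

end GaloisCode

/-! ### The shortened code: check polynomial, trace words and counting. -/

namespace GaloisCode

section Words

variable {A : Type*} [CommRing A]

theorem wordPoly_apply (n : ℕ) (c : Fin n → A) :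
    wordPoly A n c = ∑ i : Fin n, monomial (i : ℕ) (c i) := by
  simp [wordPoly]

theorem coeff_wordPoly (n : ℕ) (c : Fin n → A) (i : Fin n) :
    (wordPoly A n c).coeff i = c i := by
  rw [wordPoly_apply, finsetSum_coeff, Finset.sum_eq_single i]
  · simp
  · intro j _ hj
    rw [coeff_monomial, if_neg]
    exact fun h => hj (Fin.ext h)
  · simp

theorem natDegree_wordPoly_le (n : ℕ) (c : Fin n → A) : (wordPoly A n c).natDegree ≤ n - 1 := by
  rw [wordPoly_apply]
  refine natDegree_sum_le_of_forall_le _ _ fun i _ => (natDegree_monomial_le _).trans ?_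
  have := i.2
  omega

theorem mem_cyclicCode_iff (n : ℕ) (g : A[X]) (c : Fin n → A) :
    c ∈ cyclicCode n g ↔ ∃ d e : A[X], wordPoly A n c = g * d + (X ^ n - 1) * e := by
  change AdjoinRoot.mk (X ^ n - 1 : A[X]) (wordPoly A n c) ∈
    Ideal.span {AdjoinRoot.mk (X ^ n - 1 : A[X]) g} ↔ _
  rw [Ideal.mem_span_singleton]
  constructor
  · rintro ⟨d, hd⟩
    obtain ⟨d, rfl⟩ := AdjoinRoot.mk_surjective d
    rw [← map_mul, AdjoinRoot.mk_eq_mk] at hd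
    obtain ⟨e, he⟩ := hd
    exact ⟨d, e, by linear_combination he⟩
  · rintro ⟨d, e, hde⟩
    rw [hde]
    simp

theorem monic_X_pow_sub_one {n : ℕ} (hn : n ≠ 0) : (X ^ n - 1 : A[X]).Monic := by
  simpa using monic_X_pow_sub_C (1 : A) hn

theorem natDegree_X_pow_sub_one [Nontrivial A] (n : ℕ) : (X ^ n - 1 : A[X]).natDegree = n := by
  simpa using natDegree_X_pow_sub_C (n := n) (r := (1 : A))

theorem reverse_X_pow_sub_one [Nontrivial A] (n : ℕ) :
    (X ^ n - 1 : A[X]).reverse = -(X ^ n - 1) := by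
  rw [reverse, natDegree_X_pow_sub_one, reflect_sub, reflect_one, reflect_monomial,
    revAt_le le_rfl, Nat.sub_self, pow_zero, neg_sub]

theorem reverse_mul_monic [Nontrivial A] {f g : A[X]} (hf : f.Monic) (hg : g.Monic) :
    (f * g).reverse = f.reverse * g.reverse :=
  reverse_mul (by rw [hf.leadingCoeff, hg.leadingCoeff, one_mul]; exact one_ne_zero)

theorem reverse_X_sub_C [Nontrivial A] (a : A) : (X - C a).reverse = 1 - C a * X := by
  rw [reverse, natDegree_X_sub_C, reflect_sub, reflect_one_X, reflect_C, pow_one]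

theorem reverse_map [Nontrivial A] {B : Type*} [CommRing B] [Nontrivial B] (f : A →+* B) {g : A[X]}
    (hg : g.Monic) : g.reverse.map f = (g.map f).reverse := by
  rw [reverse, reverse, ← reflect_map, hg.natDegree_map]

/-- A root `a` of `F` puts the factor `1 - aX` into the reciprocal, and `(aX - 1) ∑ (aX)^i = X^n -
1` because `a^n = 1`. -/
theorem X_pow_sub_one_dvd_geom_sum_mul_reverse [Nontrivial A] {n : ℕ} {F : A[X]} (hF : F.Monic)
    {a : A} (ha : a ^ n = 1) (hroot : F.eval a = 0) :
    X ^ n - 1 ∣ (∑ i ∈ Finset.range n, (C a * X) ^ i) * F.reverse := by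
  obtain ⟨G, rfl⟩ := dvd_iff_isRoot.2 hroot
  have hG : G.Monic := (monic_X_sub_C a).of_mul_monic_left hF
  rw [reverse_mul_monic (monic_X_sub_C a) hG, reverse_X_sub_C]
  refine ⟨-G.reverse, ?_⟩
  have h1 := geom_sum_mul (C a * X) n
  rw [mul_pow, ← C_pow, ha, C_1, one_mul] at h1
  linear_combination (-G.reverse) * h1

end Words

namespace KerdockSetting

variable {p s r m q n : ℕ} {L R : Type*} [CommRing L] [CommRing R] [Algebra L R]
  {h : L[X]} {ξ : R}

theorem n_ne_zero (S : KerdockSetting p s r m q n h ξ) : n ≠ 0 := by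
  have := S.two_le_n
  omega

/-- Otherwise `1` would be a root of the primitive reduction of `h`, forcing `n = 1`. It follows
that `X - 1` divides the cofactor of `h` in `X^n - 1`. -/
theorem isUnit_eval_one (S : KerdockSetting p s r m q n h ξ) : IsUnit (h.eval 1) := by
  refine (S.base.isUnit_or_dvd _).resolve_right fun hd => ?_
  have := S.base.isMaximal
  let _ := Ideal.Quotient.field (Ideal.span {(p : L)})
  have h1 := orderOf_eq_orderOf_root (RingHom.id (L ⧸ Ideal.span {(p : L)})) S.primitive.2.1
    (β := 1) (by
      rw [← eval, eval_one_map, Ideal.Quotient.eq_zero_iff_mem, Ideal.mem_span_singleton]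
      exact hd)
  have := S.nontrivial_base
  rw [S.primitive.2.2, S.primitive.1.natDegree_map, S.natDegree_eq, S.card_residue_base,
    ← S.n_eq, orderOf_one] at h1
  have := S.two_le_n
  omega

theorem monic_check (S : KerdockSetting p s r m q n h ξ) : ((X - 1) * h).Monic := by
  have := monic_X_sub_C (1 : L)
  rw [C_1] at this
  exact this.mul S.primitive.1

theorem check_dvd (S : KerdockSetting p s r m q n h ξ) : (X - 1) * h ∣ X ^ n - 1 := by
  obtain ⟨g, hg⟩ := S.dvd
  have h1 := congrArg (eval 1) hg
  simp only [eval_sub, eval_pow, eval_X, one_pow, eval_one, sub_self, eval_mul] at h1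
  have h2 : X - C 1 ∣ g := dvd_iff_isRoot.2 (S.isUnit_eval_one.mul_right_eq_zero.1 h1.symm)
  obtain ⟨k, rfl⟩ := h2
  exact ⟨k, by rw [hg, C_1]; ring⟩

theorem reverse_check_mul_generator (S : KerdockSetting p s r m q n h ξ) :
    ((X - 1) * h).reverse * kerdockGenerator n h = -(X ^ n - 1) := by
  have := S.nontrivial_base
  have h1 : (X - 1) * h * ((X ^ n - 1) /ₘ ((X - 1) * h)) = X ^ n - 1 := by
    obtain ⟨g, hg⟩ := S.check_dvd
    rw [hg, mul_divByMonic_cancel_left g S.monic_check]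
  have h2 : ((X ^ n - 1) /ₘ ((X - 1) * h)).Monic :=
    S.monic_check.of_mul_monic_left (by rw [h1]; exact monic_X_pow_sub_one S.n_ne_zero)
  rw [kerdockGenerator, ← reverse_mul_monic S.monic_check h2, h1, reverse_X_pow_sub_one]

theorem mem_shortenedKerdock_iff (S : KerdockSetting p s r m q n h ξ) (c : Fin n → L) :
    c ∈ shortenedKerdock n h ↔ X ^ n - 1 ∣ wordPoly L n c * ((X - 1) * h).reverse := by
  have hG := S.reverse_check_mul_generator
  rw [shortenedKerdock, mem_cyclicCode_iff]
  constructor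
  · rintro ⟨d, e, hde⟩
    exact ⟨-d + e * ((X - 1) * h).reverse, by rw [hde]; linear_combination d * hG⟩
  · rintro ⟨d, hd⟩
    refine ⟨-d, 0, ?_⟩
    -- It suffices to compare after multiplying by the regular element `X^n - 1`, which is minus the
    -- check polynomial times the generator.
    apply (monic_X_pow_sub_one S.n_ne_zero).isRegular.left
    simp only
    linear_combination (-(kerdockGenerator n h)) * hd +
      (wordPoly L n c) * hG

/-- A codeword is determined by the quotient of its product with the check polynomial by `X^n - 1`;
that quotient has degree at most `(n-1) + (m+1) - n = m`. -/
theorem card_shortenedKerdock_le (S : KerdockSetting p s r m q n h ξ) :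
    Nat.card (shortenedKerdock n h) ≤ Nat.card L ^ (m + 1) := by
  have := S.finite_base
  have := S.nontrivial_base
  have hmon : (X ^ n - 1 : L[X]).Monic := monic_X_pow_sub_one S.n_ne_zero
  choose d hd using fun c : shortenedKerdock n h => (S.mem_shortenedKerdock_iff c).1 c.2
  have hdeg : ∀ c, (d c).natDegree < m + 1 := by
    intro c
    by_cases h0 : d c = 0
    · rw [h0, natDegree_zero]
      omega
    have h1 := congrArg natDegree (hd c)
    rw [hmon.natDegree_mul' h0, natDegree_X_pow_sub_one] at h1
    have h2 : (wordPoly L n c * ((X - 1) * h).reverse).natDegree ≤ (n - 1) + (m + 1) := by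
      refine natDegree_mul_le_of_le (natDegree_wordPoly_le n _)
        ((reverse_natDegree_le _).trans (natDegree_mul_le_of_le ?_ S.natDegree_eq.le |>.trans
          (by omega : 1 + m ≤ m + 1)))
      rw [← C_1]
      exact natDegree_X_sub_C_le 1
    have := S.two_le_n
    omega
  have hinj : Function.Injective
      (fun (c : shortenedKerdock n h) (j : Fin (m + 1)) => (d c).coeff j) := by
    intro c c' hcc
    have h1 : d c = d c' := by
      ext i
      by_cases hi : i < m + 1
      · exact congrFun hcc ⟨i, hi⟩
      · rw [coeff_eq_zero_of_natDegree_lt (by have := hdeg c; omega),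
          coeff_eq_zero_of_natDegree_lt (by have := hdeg c'; omega)]
    have h2 : wordPoly L n c = wordPoly L n c' := by
      apply hmon.isRegular.left
      have h3 := hd c
      have h4 := hd c'
      rw [← h1] at h4
      have hG := S.reverse_check_mul_generator
      simp only
      linear_combination (kerdockGenerator n h) * (h4 - h3) +
        (wordPoly L n c - wordPoly L n c') * hG
    ext i
    rw [← coeff_wordPoly n c.1 i, h2, coeff_wordPoly]
  refine (Nat.card_le_card_of_injective _ hinj).trans ?_
  rw [Nat.card_fun, Nat.card_fin]

/-- The word `v^(λ)`, with linear dependence on `λ`. -/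
noncomputable def word (S : KerdockSetting p s r m q n h ξ) : R →ₗ[L] (Fin n → L) :=
  LinearMap.pi fun i => S.trace ∘ₗ LinearMap.mulRight L (ξ ^ (i : ℕ))

theorem word_apply (S : KerdockSetting p s r m q n h ξ) (c : R) (i : Fin n) :
    S.word c i = S.trace (c * ξ ^ (i : ℕ)) := rfl

theorem one_mem_shortenedKerdock (S : KerdockSetting p s r m q n h ξ) :
    (1 : Fin n → L) ∈ shortenedKerdock n h := by
  have := S.nontrivial_base
  rw [S.mem_shortenedKerdock_iff]
  convert X_pow_sub_one_dvd_geom_sum_mul_reverse S.monic_check (one_pow n) (by simp) using 2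
  rw [wordPoly_apply, ← Fin.sum_univ_eq_sum_range]
  simp [← X_pow_eq_monomial]

theorem word_mem_shortenedKerdock (S : KerdockSetting p s r m q n h ξ) (c : R) :
    S.word c ∈ shortenedKerdock n h := by
  have := S.nontrivial_base
  have := S.nontrivial
  obtain ⟨φ, hφ⟩ := S.exists_frobenius
  -- Divisibility by a monic polynomial can be tested over `R`, where the trace word splits into
  -- geometric progressions of ratio `ξ^(q^k)`.
  rw [S.mem_shortenedKerdock_iff, ← map_dvd_map (algebraMap L R) S.algebraMap_injective
    (monic_X_pow_sub_one S.n_ne_zero), Polynomial.map_mul, reverse_map _ S.monic_check]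
  have h1 : (wordPoly L n (S.word c)).map (algebraMap L R) =
      ∑ k ∈ Finset.range m, C ((φ ^ k) c) * ∑ i ∈ Finset.range n, (C (ξ ^ q ^ k) * X) ^ i := by
    simp only [Finset.mul_sum]
    rw [Finset.sum_comm, wordPoly_apply, Polynomial.map_sum, ← Fin.sum_univ_eq_sum_range
      (fun i => ∑ k ∈ Finset.range m, C ((φ ^ k) c) * (C (ξ ^ q ^ k) * X) ^ i)]
    refine Finset.sum_congr rfl fun i _ => ?_
    rw [map_monomial, word_apply, S.algebraMap_trace hφ, map_sum]
    refine Finset.sum_congr rfl fun k _ => ?_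
    rw [map_mul, map_pow, pow_apply hφ, ← C_mul_X_pow_eq_monomial, C_mul, C_pow, mul_pow, mul_assoc]
  rw [h1, Finset.sum_mul]
  simp only [Polynomial.map_sub, Polynomial.map_pow, map_X, Polynomial.map_one]
  refine Finset.dvd_sum fun k _ => ?_
  rw [mul_assoc]
  refine Dvd.dvd.mul_left (X_pow_sub_one_dvd_geom_sum_mul_reverse (S.monic_check.map _) ?_ ?_) _
  · rw [pow_right_comm, S.pow_n, one_pow]
  · rw [eval_map_algebraMap, map_mul, ← pow_apply hφ, aeval_algHom_apply _ ξ h, S.aeval_eq_zero, map_zero,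
      mul_zero]

theorem trace_mul_pow_eq (S : KerdockSetting p s r m q n h ξ) {ε : L} {c : R}
    (hc : ε • (1 : Fin n → L) + S.word c = 0) (i : ℕ) : S.trace (c * ξ ^ i) = -ε := by
  have h1 := congrFun hc ⟨i % n, Nat.mod_lt _ (by have := S.two_le_n; omega)⟩
  simp only [Pi.add_apply, Pi.smul_apply, Pi.one_apply, smul_eq_mul, mul_one, word_apply,
    Pi.zero_apply] at h1
  rw [← pow_mod_orderOf, S.orderOf_eq]
  linear_combination h1

/-- `T(c ξ^i)` is then independent of `i`, so `T(c(ξ - 1)ξ^j) = 0` for all `j`; nondegeneracy and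
the unit `ξ - 1` give `c = 0`. -/
theorem eq_zero_of_word_eq_zero (S : KerdockSetting p s r m q n h ξ) {ε : L} {c : R}
    (hc : ε • (1 : Fin n → L) + S.word c = 0) : ε = 0 ∧ c = 0 := by
  have h1 := S.trace_mul_pow_eq hc
  have h2 : c * (ξ - 1) = 0 := by
    apply S.eq_zero_of_trace_pow
    intro j
    rw [show c * (ξ - 1) * ξ ^ (j : ℕ) = c * ξ ^ (j + 1 : ℕ) - c * ξ ^ (j : ℕ) by ring, map_sub,
      h1, h1, sub_self]
  have h3 := S.isUnit_sub_one.mul_left_eq_zero.1 h2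
  refine ⟨?_, h3⟩
  have h4 := h1 0
  rw [h3, zero_mul, map_zero] at h4
  exact neg_eq_zero.1 h4.symm

theorem shortenedKerdock_eq (S : KerdockSetting p s r m q n h ξ) :
    (shortenedKerdock n h : Set (Fin n → L)) =
      {c | ∃ (ε : L) (lam : R), c = ε • (1 : Fin n → L) + S.word lam} := by
  have := S.finite_base
  have := S.finite
  symm
  have hsub : {c | ∃ (ε : L) (lam : R), c = ε • (1 : Fin n → L) + S.word lam} ⊆
      (shortenedKerdock n h : Set (Fin n → L)) := by
    rintro _ ⟨ε, lam, rfl⟩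
    exact add_mem (Submodule.smul_mem _ _ S.one_mem_shortenedKerdock)
      (S.word_mem_shortenedKerdock lam)
  refine Set.eq_of_subset_of_ncard_le hsub ?_ (Set.toFinite _)
  have hrange : {c | ∃ (ε : L) (lam : R), c = ε • (1 : Fin n → L) + S.word lam} =
      Set.range (fun x : L × R => x.1 • (1 : Fin n → L) + S.word x.2) := by
    ext c
    simp [eq_comm]
  have hinj : Function.Injective (fun x : L × R => x.1 • (1 : Fin n → L) + S.word x.2) := by
    rintro ⟨ε, c⟩ ⟨ε', c'⟩ hx
    have h1 : (ε - ε') • (1 : Fin n → L) + S.word (c - c') = 0 := by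
      rw [sub_smul, map_sub]
      simp only at hx
      rw [sub_add_sub_comm, hx, sub_self]
    obtain ⟨h2, h3⟩ := S.eq_zero_of_word_eq_zero h1
    rw [sub_eq_zero.1 h2, sub_eq_zero.1 h3]
  rw [hrange, ← Nat.card_coe_set_eq, ← Nat.card_coe_set_eq, Nat.card_range_of_injective hinj,
    Nat.card_prod, S.card_eq_pow, ← pow_succ']
  exact S.card_shortenedKerdock_le

/-! ### The parity extension and the first-order Reed–Muller code. -/

theorem parityExtend_word (S : KerdockSetting p s r m q n h ξ) (ε : L) (c : R) :
    parityExtend L n (ε • (1 : Fin n → L) + S.word c) =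
      ε • (1 : Fin (n + 1) → L) + Fin.cons (0 : L) (S.word c) := by
  have h0 : ∑ i : Fin n, S.word c i = 0 := by
    simp only [word_apply]
    rw [Fin.sum_univ_eq_sum_range (fun i => S.trace (c * ξ ^ i)), ← map_sum, ← Finset.mul_sum,
      S.sum_pow, mul_zero, map_zero]
  ext i
  refine Fin.cases ?_ (fun j => ?_) i
  -- The parity symbol is `-nε = ε`.
  · simp [parityExtend, Finset.sum_add_distrib, h0, S.cast_n_base]
  · simp [parityExtend]

theorem kerdock_eq (S : KerdockSetting p s r m q n h ξ) :
    (kerdock n h : Set (Fin (n + 1) → L)) =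
      {c | ∃ (ε : L) (lam : R),
        c = ε • (1 : Fin (n + 1) → L) + Fin.cons (0 : L) (S.word lam)} := by
  rw [kerdock, Submodule.map_coe, S.shortenedKerdock_eq]
  ext c
  constructor
  · rintro ⟨_, ⟨ε, lam, rfl⟩, rfl⟩
    exact ⟨ε, lam, S.parityExtend_word ε lam⟩
  · rintro ⟨ε, lam, rfl⟩
    exact ⟨_, ⟨ε, lam, rfl⟩, S.parityExtend_word ε lam⟩

theorem sum_coord (S : KerdockSetting p s r m q n h ξ) (x : R) :
    ∑ j : Fin m, coord L m ξ x j • ξ ^ (j : ℕ) = x :=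
  Function.invFun_eq (S.linearCombination_bijective.2 x)

/-- Expanding `ξ^k` in the basis of powers turns `T(c ξ^k)` into a linear form in the coordinates,
with coefficients `T(c ξ^j)`; at the point `b_∞ = 0` only `ε` survives. -/
theorem affine_eval (S : KerdockSetting p s r m q n h ξ) (ε : L) (c : R) (i : Fin (n + 1)) :
    ε + ∑ j : Fin m, S.trace (c * ξ ^ (j : ℕ)) * evalPoint L m n ξ i j =
      (ε • (1 : Fin (n + 1) → L) + Fin.cons (0 : L) (S.word c) : Fin (n + 1) → L) i := by
  refine Fin.cases ?_ (fun k => ?_) i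
  · simp [evalPoint]
  · simp only [evalPoint, Fin.cons_succ, Pi.add_apply, Pi.smul_apply, Pi.one_apply, smul_eq_mul,
      mul_one, word_apply]
    conv_rhs => rw [← S.sum_coord (ξ ^ (k : ℕ)), Finset.mul_sum, map_sum]
    simp [mul_comm]

end KerdockSetting

theorem eq_affine_of_totalDegree_le_one {A σ : Type*} [CommRing A] [Fintype σ]
    {P : MvPolynomial σ A} (hP : P.totalDegree ≤ 1) :
    P = MvPolynomial.C (P.coeff 0) +
      ∑ j, MvPolynomial.C (P.coeff (Finsupp.single j 1)) * MvPolynomial.X j := by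
  classical
  ext d
  simp only [MvPolynomial.coeff_add, MvPolynomial.coeff_C, MvPolynomial.coeff_sum,
    MvPolynomial.coeff_C_mul, MvPolynomial.coeff_X]
  by_cases h0 : d = 0
  · subst h0
    simp
  by_cases h1 : ∃ j, d = Finsupp.single j 1
  · obtain ⟨j, rfl⟩ := h1
    rw [Finset.sum_eq_single j]
    · simp [eq_comm]
    · intro k _ hk
      simp [Finsupp.single_left_inj, hk]
    · simp
  · have h2 : P.coeff d = 0 := by
      by_contra hne
      have h3 := (MvPolynomial.le_totalDegree (MvPolynomial.mem_support_iff.2 hne)).trans hP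
      apply h1
      obtain ⟨j, hj⟩ := Finsupp.ne_iff.1 h0
      have h4 : Finsupp.single j 1 ≤ d :=
        Finsupp.single_le_iff.2 (Nat.one_le_iff_ne_zero.2 hj)
      obtain ⟨e, rfl⟩ := exists_add_of_le h4
      change (Finsupp.single j 1 + e).degree ≤ 1 at h3
      rw [map_add, Finsupp.degree_single] at h3
      exact ⟨j, by rw [(Finsupp.degree_eq_zero_iff e).1 (by omega), add_zero]⟩
    rw [h2, if_neg (Ne.symm h0), zero_add, Finset.sum_eq_zero]
    intro j _
    rw [if_neg (fun h => h1 ⟨j, h.symm⟩), mul_zero]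

namespace KerdockSetting

variable {p s r m q n : ℕ} {L R : Type*} [CommRing L] [CommRing R] [Algebra L R]
  {h : L[X]} {ξ : R}

theorem kerdock_eq_reedMuller (S : KerdockSetting p s r m q n h ξ) :
    kerdock n h = reedMuller L q m n ξ 1 := by
  have := S.nontrivial_base
  apply SetLike.coe_injective
  rw [S.kerdock_eq]
  ext w
  constructor
  · rintro ⟨ε, c, rfl⟩
    let P : MvPolynomial (Fin m) L := MvPolynomial.C ε +
      ∑ j : Fin m, MvPolynomial.C (S.trace (c * ξ ^ (j : ℕ))) * MvPolynomial.X j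
    have hP : P.totalDegree ≤ 1 := by
      refine (MvPolynomial.totalDegree_add _ _).trans (max_le ?_ ?_)
      · simp
      · refine MvPolynomial.totalDegree_finsetSum_le fun j _ => ?_
        refine (MvPolynomial.totalDegree_mul _ _).trans ?_
        simp
    refine ⟨P, ⟨?_, ?_⟩, ?_⟩
    · rw [SetLike.mem_coe, MvPolynomial.mem_restrictDegree]
      intro d hd i
      have h1 := (MvPolynomial.le_totalDegree hd).trans hP
      -- Total degree at most `1` already bounds each partial degree by `q - 1`, since `q ≥ 2`.
      have h2 : d i ≤ d.sum fun _ e => e := Finsupp.le_degree i d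
      have := S.two_le_q
      omega
    · rw [SetLike.mem_coe, MvPolynomial.mem_restrictTotalDegree]
      exact hP
    · ext i
      rw [← S.affine_eval]
      simp [ev, P]
  · rintro ⟨P, ⟨-, hP⟩, rfl⟩
    rw [SetLike.mem_coe, MvPolynomial.mem_restrictTotalDegree] at hP
    obtain ⟨c, hc⟩ := S.exists_trace_pow_eq (fun j => P.coeff (Finsupp.single j 1))
    refine ⟨P.coeff 0, c, ?_⟩
    ext i
    rw [← S.affine_eval]
    conv_lhs => rw [eq_affine_of_totalDegree_le_one hP]
    simp [ev, hc]

end KerdockSetting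

end GaloisCode

theorem mainTheorem6
    (p s r m q n : ℕ) (hp : p.Prime) (hs : 1 ≤ s) (hr : 1 ≤ r) (hm : 1 ≤ m)
    (hrm : s ≤ r * m) (hq : q = p ^ r) (hn : n = q ^ m - 1) (hqm : q ^ m ≠ 2)
    {L R : Type*} [CommRing L] [CommRing R] [Algebra L R]
    (hL : GaloisCode.IsGaloisRing p s r L) (hR : GaloisCode.IsGaloisRing p s (r * m) R)
    (h : Polynomial L) (hh : GaloisCode.IsMonicBasicPrimitive p h) (hdeg : h.natDegree = m)
    (hdvd : h ∣ Polynomial.X ^ n - 1)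
    (ξ : R) (hroot : Polynomial.aeval ξ h = 0) (hξ : orderOf ξ = n) :
    (GaloisCode.shortenedKerdock n h : Set (Fin n → L)) =
        {c | ∃ (ε : L) (lam : R),
          c = ε • (1 : Fin n → L) + GaloisCode.traceWord L p s q m n ξ lam} ∧
      (GaloisCode.kerdock n h : Set (Fin (n + 1) → L)) =
        {c | ∃ (ε : L) (lam : R),
          c = ε • (1 : Fin (n + 1) → L) +
            Fin.cons (0 : L) (GaloisCode.traceWord L p s q m n ξ lam)} ∧
      GaloisCode.kerdock n h = GaloisCode.reedMuller L q m n ξ 1 := by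
  have S : GaloisCode.KerdockSetting p s r m q n h ξ :=
    ⟨hp, hs, hr, hm, hrm, hq, hn, hqm, hL, hR, hh, hdeg, hdvd, hroot, hξ⟩
  exact ⟨S.shortenedKerdock_eq, S.kerdock_eq, S.kerdock_eq_reedMuller⟩
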